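/- Let $K$ be an algebraically closed field of characteristic $0$ (for instance $K=\mathbb{C}$). *Definitions.* For a finite-dimensional Lie algebra $\mathfrak g$ over $K$ and $x\in\mathfrak g^*$ let $\mathcal A_x$ be the skew-symmetric bilinear form $\mathcal A_x(\xi,\eta)=\langle x,[\xi,\eta]\rangle$ on $\mathfrak g$. By the Jordan--Kronecker theorem, any pair $(A,B)$ of skew-symmetric forms on a finite-dimensional $K$-vector space is, in a suitable basis, block-diagonal with blocks $A_i=\begin{pmatrix}0&X\\-X^T&0\end{pmatrix}$, $B_i=\begin{pmatrix}0&Y\\-Y^T&0\end{pmatrix}$, where $(X,Y)$ is one of: $(J_n(\lambda),E_n)$ with $n\ge 1$, $\lambda\in K$ (Jordan $2n\times 2n$ block with eigenvalue $\lambda$; $J_n(\lambda)$ is the upper triangular Jordan cell); $(E_n,J_n(0))$ with $n\ge1$ (Jordan $2n\times 2n$ block with eigenvalue $\infty$); or the two $m\times(m+1)$ matrices $X=(E_m\,|\,0)$, $Y=(0\,|\,E_m)$ with $m\ge 0$ (Kronecker $(2m+1)\times(2m+1)$ block). The Jordan--Kronecker (JK) invariants of $\mathfrak g$ are the sizes of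 the Kronecker blocks, together with the sizes of the Jordan blocks grouped by eigenvalue (the values of the eigenvalues being forgotten), of the pair $(\mathcal A_x,\mathcal A_a)$ for all $(x,a)$ in some non-empty Zariski open subset of $\mathfrak g^*\times\mathfrak g^*$. **Theorem.** 1. For every $m\ge 0$ there is a Lie algebra over $K$ with basis $g_1,\dots,g_m,h_0,\dots,h_m$ and bracket $[g_i,h_0]=h_0$, $[g_i,h_i]=h_i$ ($i=1,\dots,m$), all other commutators of basis elements being $0$. The JK invariants of this Lie algebra consist of a single Kronecker $(2m+1)\times(2m+1)$ block (and no Jordan blocks). 2. For any $m_1,\dots,m_q\ge 0$, $q\ge 0$, the JK invariants of the direct sum of the Lie algebras from part 1 with $m=m_1,\dots,m_q$ consist of exactly the Kronecker blocks of sizes $2m_1+1,\dots,2m_q+1$ (and no Jordan blocks). Consequently, every finite collection (multiset) of odd positive integers is the collection of Kronecker sizes of a finite-dimensional Lie algebra over $K$ whose JK invariants contain no Jordan blocks. -/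

import Mathlib

universe u v

/-! ### Canonical blocks of a pair of skew-symmetric forms -/

/-- The types of blocks in the Jordan--Kronecker normal form of a pair of skew-symmetric forms:
a Jordan block of size `2n × 2n` (`n ≥ 1`) with eigenvalue `lam ∈ K`, a Jordan block of size
`2n × 2n` with eigenvalue `∞`, and a Kronecker block of size `(2m+1) × (2m+1)` (`m ≥ 0`), that is,
with Kronecker index `k = m + 1` and size `2k - 1`. -/
inductive JKBlock (K : Type u) : Type u
  | jordan (lam : K) (n : ℕ+) : JKBlock K
  | jordanInfty (n : ℕ+) : JKBlock K
  | kronecker (m : ℕ) : JKBlock K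

namespace JKBlock

/-- The index set of the standard basis of a block. -/
abbrev Index {K : Type u} : JKBlock K → Type
  | jordan _ n => Fin n ⊕ Fin n
  | jordanInfty n => Fin n ⊕ Fin n
  | kronecker m => Fin m ⊕ Fin (m + 1)

/-- The upper triangular `n × n` Jordan cell with eigenvalue `lam`. -/
def cell {K : Type u} [Field K] (n : ℕ) (lam : K) : Matrix (Fin n) (Fin n) K :=
  Matrix.of fun i j => if j = i then lam else if (j : ℕ) = i + 1 then 1 else 0

/-- The `m × (m+1)` matrix `(E | 0)`. -/
def kronP (K : Type u) [Field K] (m : ℕ) : Matrix (Fin m) (Fin (m + 1)) K :=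
  Matrix.of fun i j => if j = i.castSucc then 1 else 0

/-- The `m × (m+1)` matrix `(0 | E)`. -/
def kronQ (K : Type u) [Field K] (m : ℕ) : Matrix (Fin m) (Fin (m + 1)) K :=
  Matrix.of fun i j => if j = i.succ then 1 else 0

/-- The skew-symmetric matrix with off-diagonal blocks `X` and `-Xᵀ`. -/
def skew {K : Type u} [Field K] {p q : ℕ} (X : Matrix (Fin p) (Fin q) K) :
    Matrix (Fin p ⊕ Fin q) (Fin p ⊕ Fin q) K :=
  Matrix.fromBlocks 0 X (-X.transpose) 0

/-- The matrix of the first form `A` on a block. -/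
def matA {K : Type u} [Field K] : (β : JKBlock K) → Matrix β.Index β.Index K
  | jordan lam n => skew (cell n lam)
  | jordanInfty n => skew (1 : Matrix (Fin n) (Fin n) K)
  | kronecker m => skew (kronP K m)

/-- The matrix of the second form `B` on a block. -/
def matB {K : Type u} [Field K] : (β : JKBlock K) → Matrix β.Index β.Index K
  | jordan _ n => skew (1 : Matrix (Fin n) (Fin n) K)
  | jordanInfty n => skew (cell n (0 : K))
  | kronecker m => skew (kronQ K m)

/-- The size of a Kronecker block (`none` for Jordan blocks). -/
def kroneckerSize {K : Type u} : JKBlock K → Option ℕ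
  | jordan _ _ => none
  | jordanInfty _ => none
  | kronecker m => some (2 * m + 1)

/-- The eigenvalue in `K ∪ {∞}` and the size of a Jordan block (`none` for Kronecker blocks). -/
def jordanData {K : Type u} : JKBlock K → Option (OnePoint K × ℕ)
  | jordan lam n => some ((lam : OnePoint K), 2 * n)
  | jordanInfty n => some (OnePoint.infty, 2 * n)
  | kronecker _ => none

end JKBlock

/-! ### The algebraic type of a linear pencil -/

/-- A multiset of tuples (sizes of the Jordan blocks, one tuple for each eigenvalue) and numbers
(sizes of the Kronecker blocks). -/
@[ext]
structure AlgebraicType where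
  jordanTuples : Multiset (List ℕ)
  kroneckerSizes : Multiset ℕ

open Classical in
/-- The algebraic type of a multiset of blocks: sizes of Jordan blocks are grouped by eigenvalues
into tuples sorted in descending order, and the values of the eigenvalues are forgotten. -/
noncomputable def algebraicTypeOfBlocks {K : Type u} (s : Multiset (JKBlock K)) :
    AlgebraicType where
  jordanTuples :=
    ((s.filterMap JKBlock.jordanData).map Prod.fst).toFinset.val.map fun lam =>
      (((s.filterMap JKBlock.jordanData).filter fun d => d.1 = lam).map Prod.snd).sort (· ≥ ·)
  kroneckerSizes := s.filterMap JKBlock.kroneckerSize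

/-- `A` and `B` are simultaneously brought to the block-diagonal Jordan--Kronecker normal form with
blocks `β 0, …, β (N-1)` in some basis of `V`. -/
def HasJKForm {K : Type u} [Field K] {V : Type v} [AddCommGroup V] [Module K V]
    (A B : LinearMap.BilinForm K V) {N : ℕ} (β : Fin N → JKBlock K) : Prop :=
  ∃ b : Module.Basis (Σ i, (β i).Index) K V,
    (∀ (i : Fin N) (s t : (β i).Index),
      A (b ⟨i, s⟩) (b ⟨i, t⟩) = (β i).matA s t ∧ B (b ⟨i, s⟩) (b ⟨i, t⟩) = (β i).matB s t) ∧
    (∀ (i j : Fin N), i ≠ j → ∀ (s : (β i).Index) (t : (β j).Index),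
      A (b ⟨i, s⟩) (b ⟨j, t⟩) = 0 ∧ B (b ⟨i, s⟩) (b ⟨j, t⟩) = 0)

/-- The linear pencil `A + λ B` has algebraic type `τ`. -/
def HasAlgebraicType {K : Type u} [Field K] {V : Type v} [AddCommGroup V] [Module K V]
    (A B : LinearMap.BilinForm K V) (τ : AlgebraicType) : Prop :=
  ∃ (N : ℕ) (β : Fin N → JKBlock K), HasJKForm A B β ∧
    algebraicTypeOfBlocks (Finset.univ.val.map β) = τ

/-! ### Zariski open sets -/

/-- The algebra of polynomial functions on a vector space `W`, generated by the linear ones. -/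
def polyFunctionAlgebra (K : Type u) [Field K] (W : Type v) [AddCommGroup W] [Module K W] :
    Subalgebra K (W → K) :=
  Algebra.adjoin K (Set.range fun (f : Module.Dual K W) (w : W) => f w)

/-- `U` is Zariski open: its complement is the set of common zeros of a family of polynomials. -/
def IsZariskiOpen (K : Type u) [Field K] {W : Type v} [AddCommGroup W] [Module K W]
    (U : Set W) : Prop :=
  ∃ S : Set (W → K), S ⊆ polyFunctionAlgebra K W ∧ Uᶜ = {w | ∀ f ∈ S, f w = 0}

/-! ### Jordan--Kronecker invariants of a Lie algebra -/

/-- The form `𝒜_x (ξ, η) = ⟨x, [ξ, η]⟩` on a Lie algebra `L`, for `x` in the dual space. -/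
def lieForm {K : Type u} [Field K] {L : Type v} [LieRing L] [LieAlgebra K L]
    (x : Module.Dual K L) : LinearMap.BilinForm K L :=
  LinearMap.mk₂ K (fun ξ η => x ⁅ξ, η⁆) (by simp) (by simp) (by simp) (by simp)

/-- The Jordan--Kronecker invariants of the Lie algebra `L` are `τ`: the pencil
`𝒜_x + λ 𝒜_a` has algebraic type `τ` for all `(x, a)` in a non-empty Zariski open subset
of `L* × L*`. -/
def HasJKInvariants (K : Type u) [Field K] (L : Type v) [LieRing L] [LieAlgebra K L]
    (τ : AlgebraicType) : Prop :=
  ∃ U : Set (Module.Dual K L × Module.Dual K L), U.Nonempty ∧ IsZariskiOpen K U ∧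
    ∀ p ∈ U, HasAlgebraicType (lieForm p.1) (lieForm p.2) τ

/-- The basis `g_1, …, g_m, h_0, …, h_m` of `L` (with `g_(i+1) = b (inl i)` and `h_j = b (inr j)`)
satisfies `[g_i, h_0] = h_0`, `[g_i, h_i] = h_i`, and all other commutators of basis elements
vanish. -/
structure IsKroneckerBasis {K : Type u} [Field K] {L : Type v} [LieRing L] [LieAlgebra K L]
    {m : ℕ} (b : Module.Basis (Fin m ⊕ Fin (m + 1)) K L) : Prop where
  lie_g_h_zero : ∀ i, ⁅b (Sum.inl i), b (Sum.inr 0)⁆ = b (Sum.inr 0)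
  lie_g_h_self : ∀ i, ⁅b (Sum.inl i), b (Sum.inr i.succ)⁆ = b (Sum.inr i.succ)
  lie_g_h_other : ∀ i j, j ≠ 0 → j ≠ i.succ → ⁅b (Sum.inl i), b (Sum.inr j)⁆ = 0
  lie_g_g : ∀ i j, ⁅b (Sum.inl i), b (Sum.inl j)⁆ = 0
  lie_h_h : ∀ i j, ⁅b (Sum.inr i), b (Sum.inr j)⁆ = 0

/-! ### Polynomial functions -/

/-! The spans of the `g`'s and of the `h`'s are abelian, so `𝒜_x` is determined by its `g`-`h`
block: an arrow matrix whose first column is constantly `x(h_0)` and whose remaining columns form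
the diagonal matrix of the `x(h_k)`. Passing from `x` to `a` multiplies column `k` by `ν_k = a(h_k)
/ x(h_k)`. For generic `(x, a)` the `ν_k` are defined and distinct. Combining the rows with
coefficients `c_k ν_k^i`, where the `c_k` are Lagrange weights, makes the first column follow the
same power law as the others. Both blocks then consist of consecutive rows of one invertible
weighted Vandermonde matrix `F`: the first `m` rows for `x`, the last `m` for `a`. Multiplying by
`F⁻¹` leaves `(E | 0)` and `(0 | E)`, a single Kronecker block (`exists_arrowMatrix_normalForm`).

In a direct sum different summands commute, so the blocks are collected, and the product of the
genericity polynomials of the summands cuts out the open set. -/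

theorem linear_mem_polyFunctionAlgebra {K : Type u} [Field K] {W : Type v} [AddCommGroup W]
    [Module K W] (f : Module.Dual K W) : (fun w => f w) ∈ polyFunctionAlgebra K W :=
  Algebra.subset_adjoin ⟨f, rfl⟩

theorem isZariskiOpen_ne_zero {K : Type u} [Field K] {W : Type v} [AddCommGroup W] [Module K W]
    {f : W → K} (hf : f ∈ polyFunctionAlgebra K W) : IsZariskiOpen K {w | f w ≠ 0} := by
  refine ⟨{f}, by simpa using hf, ?_⟩
  ext w
  simp

theorem fst_apply_mem_polyFunctionAlgebra {K : Type u} [Field K] {L : Type v} [AddCommGroup L]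
    [Module K L] (h : L) :
    (fun p : Module.Dual K L × Module.Dual K L => p.1 h) ∈
      polyFunctionAlgebra K (Module.Dual K L × Module.Dual K L) :=
  linear_mem_polyFunctionAlgebra
    ((Module.Dual.eval K L h).comp (LinearMap.fst K (Module.Dual K L) (Module.Dual K L)))

theorem snd_apply_mem_polyFunctionAlgebra {K : Type u} [Field K] {L : Type v} [AddCommGroup L]
    [Module K L] (h : L) :
    (fun p : Module.Dual K L × Module.Dual K L => p.2 h) ∈
      polyFunctionAlgebra K (Module.Dual K L × Module.Dual K L) :=
  linear_mem_polyFunctionAlgebra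
    ((Module.Dual.eval K L h).comp (LinearMap.snd K (Module.Dual K L) (Module.Dual K L)))

/-! ### Generic pairs of functionals -/

/-- The polynomial in `(x, a)` that vanishes where some `x (h k)` is zero or two of the ratios
`a (h k) / x (h k)` coincide. -/
def genericityPoly {K : Type u} [Field K] {L : Type v} [AddCommGroup L] [Module K L] {n : ℕ}
    (h : Fin n → L) (p : Module.Dual K L × Module.Dual K L) : K :=
  (∏ k, p.1 (h k)) *
    ∏ e ∈ (Finset.univ : Finset (Fin n)).offDiag,
      (p.2 (h e.1) * p.1 (h e.2) - p.2 (h e.2) * p.1 (h e.1))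

theorem genericityPoly_mem {K : Type u} [Field K] {L : Type v} [AddCommGroup L] [Module K L]
    {n : ℕ} (h : Fin n → L) :
    genericityPoly h ∈ polyFunctionAlgebra K (Module.Dual K L × Module.Dual K L) := by
  have key : genericityPoly (K := K) h =
      (∏ k, fun p : Module.Dual K L × Module.Dual K L => p.1 (h k)) *
      ∏ e ∈ (Finset.univ : Finset (Fin n)).offDiag,
        ((fun p : Module.Dual K L × Module.Dual K L => p.2 (h e.1)) * (fun p => p.1 (h e.2)) -
          (fun p => p.2 (h e.2)) * (fun p => p.1 (h e.1))) := by
    ext p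
    simp [genericityPoly, Finset.prod_apply]
  rw [key]
  refine mul_mem (prod_mem fun k _ => fst_apply_mem_polyFunctionAlgebra _)
    (prod_mem fun e _ => sub_mem (mul_mem ?_ ?_) (mul_mem ?_ ?_))
  all_goals first
    | exact fst_apply_mem_polyFunctionAlgebra _
    | exact snd_apply_mem_polyFunctionAlgebra _

/-- Clearing denominators is reversible where all `x (h k)` are nonzero. The polynomial side gives
Zariski openness, the ratio side gives the interpolation nodes. -/
theorem genericityPoly_ne_zero_iff {K : Type u} [Field K] {L : Type v} [AddCommGroup L]
    [Module K L] {n : ℕ} (h : Fin n → L) (x a : Module.Dual K L) :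
    genericityPoly h (x, a) ≠ 0 ↔
      (∀ k, x (h k) ≠ 0) ∧ Function.Injective fun k => a (h k) / x (h k) := by
  simp only [genericityPoly, mul_ne_zero_iff, Finset.prod_ne_zero_iff, Finset.mem_univ,
    true_implies, Finset.mem_offDiag, true_and, sub_ne_zero, Prod.forall]
  refine and_congr_right fun hx => ⟨fun H j k hjk => ?_, fun H j k hjk => ?_⟩
  · by_contra hne
    exact H j k hne ((div_eq_div_iff (hx j) (hx k)).mp hjk)
  · intro he
    exact hjk (H ((div_eq_div_iff (hx j) (hx k)).mpr he))

/-! ### Normal form of a generic pencil -/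

/-- Lagrange interpolation of the monomials of degree `< m` through `m` of `m + 1` distinct nodes,
evaluated at the remaining node; all the coefficients are nonzero. -/
theorem exists_interpolation_weights {K : Type u} [Field K] {m : ℕ} (ν : Fin (m + 1) → K)
    (hν : Function.Injective ν) :
    ∃ c : Fin m → K, (∀ k, c k ≠ 0) ∧
      ∀ i : Fin m, ∑ k, c k * ν k.succ ^ (i : ℕ) = ν 0 ^ (i : ℕ) := by
  have hinj : Set.InjOn (fun k : Fin m => ν k.succ) (Finset.univ : Finset (Fin m)) :=
    (hν.comp (Fin.succ_injective m)).injOn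
  refine ⟨fun k => (Lagrange.basis Finset.univ (fun k : Fin m => ν k.succ) k).eval (ν 0),
    fun k => ?_, fun i => ?_⟩
  -- The roots of the `k`-th Lagrange polynomial are the other nodes, and `ν 0` is none of them.
  · simp only [Lagrange.basis, Polynomial.eval_prod, Finset.prod_ne_zero_iff]
    intro j hj
    have hjk : j ≠ k := Finset.ne_of_mem_erase hj
    have h1 : ν k.succ ≠ ν j.succ := fun h => hjk (Fin.succ_injective _ (hν h)).symm
    have h2 : ν 0 ≠ ν j.succ := fun h => (Fin.succ_ne_zero j) (hν h).symm
    simp [Lagrange.basisDivisor, sub_ne_zero, h1, h2]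
  -- A monomial of degree `i < m` equals its own interpolant through `m` nodes.
  · have hX := Lagrange.eq_interpolate (f := (Polynomial.X ^ (i : ℕ) : Polynomial K)) hinj
      (by rw [Polynomial.degree_X_pow]; simp)
    have := congrArg (Polynomial.eval (ν 0)) hX
    rw [Lagrange.interpolate_apply, Polynomial.eval_finsetSum] at this
    simp only [Polynomial.eval_pow, Polynomial.eval_X, Polynomial.eval_mul,
      Polynomial.eval_C] at this
    rw [this]
    exact Finset.sum_congr rfl fun k _ => mul_comm _ _

/-- The matrix with first column constant `z 0`, followed by `diag (z 1, …, z m)`. -/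
def arrowMatrix {K : Type u} [Field K] {m : ℕ} (z : Fin (m + 1) → K) :
    Matrix (Fin m) (Fin (m + 1)) K :=
  Matrix.of fun k l => if l = 0 then z 0 else if l = k.succ then z l else 0

theorem arrowMatrix_zero {K : Type u} [Field K] {m : ℕ} (z : Fin (m + 1) → K) (k : Fin m) :
    arrowMatrix z k 0 = z 0 := by simp [arrowMatrix]

theorem arrowMatrix_succ {K : Type u} [Field K] {m : ℕ} (z : Fin (m + 1) → K) (k l : Fin m) :
    arrowMatrix z k l.succ = if l = k then z l.succ else 0 := by
  simp [arrowMatrix]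

/-- The pencil of arrow matrices of a generic pair is strictly equivalent to the Kronecker
pencil. -/
theorem exists_arrowMatrix_normalForm {K : Type u} [Field K] {m : ℕ} (x a : Fin (m + 1) → K)
    (hx : ∀ k, x k ≠ 0) (hν : Function.Injective fun k => a k / x k) :
    ∃ (P : Matrix (Fin m) (Fin m) K) (Q : Matrix (Fin (m + 1)) (Fin (m + 1)) K),
      IsUnit P.det ∧ IsUnit Q.det ∧
      P.transpose * arrowMatrix x * Q = JKBlock.kronP K m ∧
      P.transpose * arrowMatrix a * Q = JKBlock.kronQ K m := by
  set ν : Fin (m + 1) → K := fun k => a k / x k with hνdef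
  have hax : ∀ k, a k = x k * ν k := fun k => by simp [hνdef, mul_div_cancel₀ _ (hx k)]
  obtain ⟨c, hc, hsum⟩ := exists_interpolation_weights ν hν
  -- The weight `1` in position `0` matches the right-hand side `ν 0 ^ i` of the interpolation
  -- identity.
  set d : Fin (m + 1) → K := Fin.cons 1 c with hd
  have hd0 : ∀ k, d k ≠ 0 := Fin.cases (by simp [hd]) (by simpa [hd] using hc)
  set F : Matrix (Fin (m + 1)) (Fin (m + 1)) K :=
    Matrix.of fun i l => d l * x l * ν l ^ (i : ℕ) with hF
  set P : Matrix (Fin m) (Fin m) K := Matrix.of fun k i => c k * ν k.succ ^ (i : ℕ) with hP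
  have hFdet : IsUnit F.det := by
    have : F = (Matrix.vandermonde ν).transpose * Matrix.diagonal fun l => d l * x l := by
      ext i l
      simp [hF, Matrix.mul_diagonal, Matrix.vandermonde_apply, mul_comm]
    rw [this, Matrix.det_mul, Matrix.det_transpose, Matrix.det_diagonal, isUnit_iff_ne_zero]
    exact mul_ne_zero (Matrix.det_vandermonde_ne_zero_iff.mpr hν)
      (Finset.prod_ne_zero_iff.mpr fun l _ => mul_ne_zero (hd0 l) (hx l))
  have hPdet : IsUnit P.det := by
    have : P = Matrix.diagonal c * Matrix.vandermonde fun k : Fin m => ν k.succ := by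
      ext k i
      simp [hP, Matrix.diagonal_mul, Matrix.vandermonde_apply]
    rw [this, Matrix.det_mul, Matrix.det_diagonal, isUnit_iff_ne_zero]
    exact mul_ne_zero (Finset.prod_ne_zero_iff.mpr fun l _ => hc l)
      (Matrix.det_vandermonde_ne_zero_iff.mpr (hν.comp (Fin.succ_injective m)))
  have hPx : P.transpose * arrowMatrix x = JKBlock.kronP K m * F := by
    ext i l
    have hR : (JKBlock.kronP K m * F) i l = d l * x l * ν l ^ (i : ℕ) := by
      simp [Matrix.mul_apply, JKBlock.kronP, hF]
    rw [hR, Matrix.mul_apply]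
    refine Fin.cases ?_ (fun l => ?_) l
    · simp only [Matrix.transpose_apply, arrowMatrix_zero, ← Finset.sum_mul]
      simp [hP, hsum, hd, mul_comm]
    · simp [arrowMatrix_succ, hP, hd, mul_right_comm]
  -- Since `a l = x l * ν l`, every exponent rises by one, which selects the next row of `F`.
  have hPa : P.transpose * arrowMatrix a = JKBlock.kronQ K m * F := by
    ext i l
    have hR : (JKBlock.kronQ K m * F) i l = d l * x l * ν l ^ ((i : ℕ) + 1) := by
      simp [Matrix.mul_apply, JKBlock.kronQ, hF]
    rw [hR, Matrix.mul_apply]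
    refine Fin.cases ?_ (fun l => ?_) l
    · simp only [Matrix.transpose_apply, arrowMatrix_zero, ← Finset.sum_mul]
      simp only [hP, Matrix.of_apply, hsum, hd, Fin.cons_zero, hax]
      ring
    · simp [arrowMatrix_succ, hP, hd, hax]
      ring
  refine ⟨P, F⁻¹, hPdet, by rwa [Matrix.det_nonsing_inv, isUnit_ringInverse], ?_, ?_⟩
  · rw [hPx, Matrix.mul_assoc, Matrix.mul_nonsing_inv _ hFdet, Matrix.mul_one]
  · rw [hPa, Matrix.mul_assoc, Matrix.mul_nonsing_inv _ hFdet, Matrix.mul_one]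

/-! ### The forms of a Lie algebra with a Kronecker basis -/

section LieAlgebra

variable {K : Type u} [Field K] {L : Type v} [LieRing L] [LieAlgebra K L]

theorem lieForm_apply (x : Module.Dual K L) (ξ η : L) : lieForm x ξ η = x ⁅ξ, η⁆ := rfl

theorem toMatrix_lieForm_of_isKroneckerBasis {m : ℕ}
    {b : Module.Basis (Fin m ⊕ Fin (m + 1)) K L} (hb : IsKroneckerBasis b)
    (x : Module.Dual K L) :
    LinearMap.BilinForm.toMatrix b (lieForm x) =
      JKBlock.skew (arrowMatrix fun k => x (b (Sum.inr k))) := by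
  have hgh : ∀ (i : Fin m) (l : Fin (m + 1)), x ⁅b (Sum.inl i), b (Sum.inr l)⁆ =
      arrowMatrix (fun k => x (b (Sum.inr k))) i l := by
    intro i l
    by_cases h0 : l = 0
    · subst h0
      rw [hb.lie_g_h_zero, arrowMatrix_zero]
    by_cases h1 : l = i.succ
    · subst h1
      rw [hb.lie_g_h_self, arrowMatrix_succ, if_pos rfl]
    · rw [hb.lie_g_h_other i l h0 h1]
      simp [arrowMatrix, h0, h1]
  ext (i | i) (j | j) <;>
    simp only [LinearMap.BilinForm.toMatrix_apply, lieForm_apply, JKBlock.skew,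
      Matrix.fromBlocks_apply₁₁, Matrix.fromBlocks_apply₁₂, Matrix.fromBlocks_apply₂₁,
      Matrix.fromBlocks_apply₂₂, Matrix.zero_apply, Matrix.neg_apply, Matrix.transpose_apply]
  · rw [hb.lie_g_g, map_zero]
  · exact hgh i j
  · rw [← lie_skew, map_neg, hgh]
  · rw [hb.lie_h_h, map_zero]

/-- A change of basis preserving the `g`-`h` splitting reduces congruence of the forms to strict
equivalence of their off-diagonal blocks. -/
theorem transpose_mul_skew_mul {p q : ℕ} (P : Matrix (Fin p) (Fin p) K)
    (Q : Matrix (Fin q) (Fin q) K) (X : Matrix (Fin p) (Fin q) K) :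
    (Matrix.fromBlocks P 0 0 Q).transpose * JKBlock.skew X * Matrix.fromBlocks P 0 0 Q =
      JKBlock.skew (P.transpose * X * Q) := by
  simp [JKBlock.skew, Matrix.fromBlocks_transpose, Matrix.fromBlocks_multiply, Matrix.mul_assoc]

theorem exists_basis_toMatrix_eq_kronecker {m : ℕ}
    {b : Module.Basis (Fin m ⊕ Fin (m + 1)) K L} (hb : IsKroneckerBasis b)
    {x a : Module.Dual K L} (h : genericityPoly (fun k => b (Sum.inr k)) (x, a) ≠ 0) :
    ∃ b' : Module.Basis (Fin m ⊕ Fin (m + 1)) K L, ∀ s t,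
      lieForm x (b' s) (b' t) = (JKBlock.kronecker m : JKBlock K).matA s t ∧
      lieForm a (b' s) (b' t) = (JKBlock.kronecker m : JKBlock K).matB s t := by
  obtain ⟨hx, hν⟩ := (genericityPoly_ne_zero_iff _ x a).mp h
  obtain ⟨P, Q, hP, hQ, hA, hB⟩ := exists_arrowMatrix_normalForm
    (fun k => x (b (Sum.inr k))) (fun k => a (b (Sum.inr k))) hx hν
  set T := Matrix.fromBlocks P 0 0 Q with hT
  have hTdet : IsUnit T.det := by
    rw [hT, Matrix.det_fromBlocks_zero₂₁]
    exact hP.mul hQ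
  have hform : ∀ y : Module.Dual K L, ∀ s t,
      lieForm y (b.map (Matrix.toLinearEquiv b T hTdet) s)
        (b.map (Matrix.toLinearEquiv b T hTdet) t) =
      JKBlock.skew (P.transpose * arrowMatrix (fun k => y (b (Sum.inr k))) * Q) s t := by
    intro y s t
    rw [← transpose_mul_skew_mul, ← toMatrix_lieForm_of_isKroneckerBasis hb, ← hT]
    -- The congruent matrix is that of the form pulled back along `T`, whose entries are the values
    -- of the form on the new basis.
    have hcomp := LinearMap.BilinForm.toMatrix_comp b b (lieForm y) (Matrix.toLin b b T)
      (Matrix.toLin b b T)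
    rw [LinearMap.toMatrix_toLin] at hcomp
    rw [← hcomp, LinearMap.BilinForm.toMatrix_apply]
    rfl
  refine ⟨b.map (Matrix.toLinearEquiv b T hTdet), fun s t => ⟨?_, ?_⟩⟩
  · rw [hform, hA]; rfl
  · rw [hform, hB]; rfl

end LieAlgebra

theorem algebraicTypeOfBlocks_kronecker (K : Type u) {q : ℕ} (m : Fin q → ℕ) :
    algebraicTypeOfBlocks (Finset.univ.val.map fun i => (JKBlock.kronecker (m i) : JKBlock K)) =
      { jordanTuples := 0, kroneckerSizes := Finset.univ.val.map fun i => 2 * m i + 1 } := by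
  have hJ : (Finset.univ.val.map fun i => (JKBlock.kronecker (m i) : JKBlock K)).filterMap
      JKBlock.jordanData = 0 := by
    rw [Multiset.filterMap_map, Multiset.eq_zero_iff_forall_notMem]
    simp [JKBlock.jordanData]
  have hKr : (Finset.univ.val.map fun i => (JKBlock.kronecker (m i) : JKBlock K)).filterMap
      JKBlock.kroneckerSize = Finset.univ.val.map fun i => 2 * m i + 1 := by
    rw [Multiset.filterMap_map, ← Multiset.filterMap_eq_map]
    rfl
  ext1
  · simp only [algebraicTypeOfBlocks, hJ]
    simp
  · exact hKr

theorem exists_genericityPoly_ne_zero {K : Type u} [Field K] [CharZero K] {L : Type v}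
    [AddCommGroup L] [Module K L] {ι : Type*} {n : ℕ} (b : Module.Basis (ι ⊕ Fin n) K L) :
    ∃ x a : Module.Dual K L, genericityPoly (fun k => b (Sum.inr k)) (x, a) ≠ 0 := by
  -- The ratios become `0, 1, …, n - 1`, distinct in characteristic zero.
  refine ⟨b.constr K fun _ => 1, b.constr K (Sum.elim 0 fun k => ((k : ℕ) : K)), ?_⟩
  rw [genericityPoly_ne_zero_iff]
  refine ⟨fun k => by simp [Module.Basis.constr_basis], fun j k hjk => ?_⟩
  simpa [Module.Basis.constr_basis, Fin.ext_iff] using hjk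

theorem hasJKInvariants_of_isKroneckerBasis {K : Type u} [Field K] [CharZero K] {m : ℕ}
    {L : Type v} [LieRing L] [LieAlgebra K L] {b : Module.Basis (Fin m ⊕ Fin (m + 1)) K L}
    (hb : IsKroneckerBasis b) :
    HasJKInvariants K L { jordanTuples := 0, kroneckerSizes := {2 * m + 1} } := by
  obtain ⟨x, a, hxa⟩ := exists_genericityPoly_ne_zero b
  refine ⟨_, ⟨(x, a), hxa⟩, isZariskiOpen_ne_zero (genericityPoly_mem _), fun p hp => ?_⟩
  obtain ⟨b', hb'⟩ := exists_basis_toMatrix_eq_kronecker hb hp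
  refine ⟨1, fun _ => JKBlock.kronecker m, ⟨b'.reindex (Equiv.uniqueSigma
    fun _ : Fin 1 => Fin m ⊕ Fin (m + 1)).symm, fun i s t => ?_, fun i j hij => ?_⟩, ?_⟩
  · have hre : ∀ s, (b'.reindex (Equiv.uniqueSigma
        fun _ : Fin 1 => Fin m ⊕ Fin (m + 1)).symm) ⟨i, s⟩ = b' s := fun s => by
      rw [Module.Basis.reindex_apply]
      obtain rfl := Subsingleton.elim i default
      rfl
    rw [hre, hre]
    exact hb' s t
  · exact absurd (Subsingleton.elim i j) hij
  · rw [algebraicTypeOfBlocks_kronecker]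
    rfl

theorem DFinsupp.basis_apply_mk {R ι : Type*} [Semiring R] [DecidableEq ι] {M : ι → Type*}
    [∀ i, AddCommMonoid (M i)] [∀ i, Module R (M i)] {η : ι → Type*}
    (b : ∀ i, Module.Basis (η i) R (M i)) (i : ι) (s : η i) :
    DFinsupp.basis b ⟨i, s⟩ = DFinsupp.single i (b i s) := by
  simp [DFinsupp.basis]

theorem hasJKInvariants_directSum {K : Type u} [Field K] [CharZero K] {q : ℕ} {m : Fin q → ℕ}
    {L : Fin q → Type v} [∀ i, LieRing (L i)] [∀ i, LieAlgebra K (L i)]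
    {b : ∀ i, Module.Basis (Fin (m i) ⊕ Fin (m i + 1)) K (L i)}
    (hb : ∀ i, IsKroneckerBasis (b i)) :
    HasJKInvariants K (DirectSum (Fin q) L)
      { jordanTuples := 0, kroneckerSizes := Finset.univ.val.map fun i => 2 * m i + 1 } := by
  set ofL : ∀ i, L i →ₗ[K] DirectSum (Fin q) L := DirectSum.lof K (Fin q) L with hof
  have hcomp : ∀ (p : Module.Dual K (DirectSum (Fin q) L) × Module.Dual K (DirectSum (Fin q) L)) i,
      genericityPoly (fun k => ofL i (b i (Sum.inr k))) p =
      genericityPoly (fun k => b i (Sum.inr k)) (p.1.comp (ofL i), p.2.comp (ofL i)) :=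
    fun p i => rfl
  have hmem : (∏ i, genericityPoly (K := K) fun k => ofL i (b i (Sum.inr k))) ∈
      polyFunctionAlgebra K _ := prod_mem fun i _ => genericityPoly_mem _
  choose x a hxa using fun i => exists_genericityPoly_ne_zero (b i)
  -- Functionals on the summands glue freely, so all factors can be made nonzero at once.
  refine ⟨_, ⟨(DirectSum.toModule K _ K x, DirectSum.toModule K _ K a), ?_⟩,
    isZariskiOpen_ne_zero hmem, fun p hp => ?_⟩
  · simp only [Set.mem_ofPred_eq, Finset.prod_apply, Finset.prod_ne_zero_iff, hcomp]
    intro i _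
    have hlof : ∀ y : ∀ i, Module.Dual K (L i),
        (DirectSum.toModule K (Fin q) K y).comp (ofL i) = y i := fun y => by
      ext z
      simp [hof, DirectSum.toModule_lof]
    rw [hlof, hlof]
    exact hxa i
  simp only [Set.mem_ofPred_eq, Finset.prod_apply, Finset.prod_ne_zero_iff, hcomp] at hp
  choose b' hb' using fun i => exists_basis_toMatrix_eq_kronecker (hb i) (hp i (Finset.mem_univ i))
  let B : Module.Basis (Σ i, Fin (m i) ⊕ Fin (m i + 1)) K (DirectSum (Fin q) L) :=
    DFinsupp.basis b'
  have hB : ∀ i s, B ⟨i, s⟩ = DirectSum.of L i (b' i s) :=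
    fun i s => DFinsupp.basis_apply_mk b' i s
  refine ⟨q, fun i => JKBlock.kronecker (m i), ⟨B, fun i s t => ?_, fun i j hij s t => ?_⟩,
    algebraicTypeOfBlocks_kronecker K m⟩
  · rw [hB, hB, lieForm_apply, lieForm_apply, DirectSum.lie_of_same]
    exact hb' i s t
  · rw [hB, hB, lieForm_apply, lieForm_apply, DirectSum.lie_of_of_ne L hij, map_zero, map_zero]
    exact ⟨rfl, rfl⟩

/-! ### Existence -/

/-- The weights of the torus `⟨g_1, …, g_m⟩` acting on `h_0, …, h_m`. -/
def kroneckerWeight (K : Type u) [Field K] (m : ℕ) :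
    (Fin m → K) →ₗ[K] (Fin (m + 1) → K) where
  toFun g := Fin.cons (∑ i, g i) g
  map_add' g g' := by
    ext j
    refine Fin.cases ?_ (fun j => ?_) j <;> simp [Finset.sum_add_distrib]
  map_smul' c g := by
    ext j
    refine Fin.cases ?_ (fun j => ?_) j <;> simp [Finset.mul_sum]

/-- The Lie algebra with basis `g_1, …, g_m, h_0, …, h_m`. -/
def KroneckerLieAlgebra (K : Type u) (m : ℕ) : Type u := (Fin m → K) × (Fin (m + 1) → K)

namespace KroneckerLieAlgebra

variable {K : Type u} [Field K] {m : ℕ}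

instance : AddCommGroup (KroneckerLieAlgebra K m) :=
  inferInstanceAs (AddCommGroup ((Fin m → K) × (Fin (m + 1) → K)))

instance : Module K (KroneckerLieAlgebra K m) :=
  inferInstanceAs (Module K ((Fin m → K) × (Fin (m + 1) → K)))

/-- This is the semidirect product of an abelian algebra with an abelian ideal on which it acts
diagonally; the Jacobi identity holds because diagonal operators commute. -/
instance : Bracket (KroneckerLieAlgebra K m) (KroneckerLieAlgebra K m) where
  bracket y z := (0, kroneckerWeight K m y.1 * z.2 - kroneckerWeight K m z.1 * y.2)

theorem lie_def (y z : KroneckerLieAlgebra K m) :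
    ⁅y, z⁆ = (0, kroneckerWeight K m y.1 * z.2 - kroneckerWeight K m z.1 * y.2) := rfl

instance : LieRing (KroneckerLieAlgebra K m) where
  add_lie x y z := Prod.ext (add_zero _).symm (by
    change kroneckerWeight K m (x.1 + y.1) * z.2 - kroneckerWeight K m z.1 * (x.2 + y.2) =
      (kroneckerWeight K m x.1 * z.2 - kroneckerWeight K m z.1 * x.2) +
      (kroneckerWeight K m y.1 * z.2 - kroneckerWeight K m z.1 * y.2)
    rw [map_add]; ring)
  lie_add x y z := Prod.ext (add_zero _).symm (by
    change kroneckerWeight K m x.1 * (y.2 + z.2) - kroneckerWeight K m (y.1 + z.1) * x.2 =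
      (kroneckerWeight K m x.1 * y.2 - kroneckerWeight K m y.1 * x.2) +
      (kroneckerWeight K m x.1 * z.2 - kroneckerWeight K m z.1 * x.2)
    rw [map_add]; ring)
  lie_self x := Prod.ext rfl (sub_self _)
  leibniz_lie x y z := Prod.ext (add_zero _).symm (by
    let χ := kroneckerWeight K m
    change χ x.1 * (χ y.1 * z.2 - χ z.1 * y.2) - χ 0 * x.2 =
      (χ 0 * z.2 - χ z.1 * (χ x.1 * y.2 - χ y.1 * x.2)) +
      (χ y.1 * (χ x.1 * z.2 - χ z.1 * x.2) - χ 0 * y.2)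
    rw [map_zero]; ring)

instance : LieAlgebra K (KroneckerLieAlgebra K m) where
  lie_smul c y z := Prod.ext (smul_zero c).symm (by
    change kroneckerWeight K m y.1 * (c • z.2) - kroneckerWeight K m (c • z.1) * y.2 =
      c • (kroneckerWeight K m y.1 * z.2 - kroneckerWeight K m z.1 * y.2)
    rw [map_smul, mul_smul_comm, smul_mul_assoc, smul_sub])

/-- The basis `g_1, …, g_m, h_0, …, h_m`. -/
noncomputable def basis (K : Type u) [Field K] (m : ℕ) :
    Module.Basis (Fin m ⊕ Fin (m + 1)) K (KroneckerLieAlgebra K m) :=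
  ((Pi.basisFun K (Fin m)).prod (Pi.basisFun K (Fin (m + 1))) :
    Module.Basis _ K ((Fin m → K) × (Fin (m + 1) → K)))

theorem basis_inl_fst (i : Fin m) : (basis K m (Sum.inl i)).1 = Pi.single i 1 :=
  (Module.Basis.prod_apply_inl_fst _ _ i).trans (Pi.basisFun_apply K _ i)

theorem basis_inl_snd (i : Fin m) : (basis K m (Sum.inl i)).2 = 0 :=
  Module.Basis.prod_apply_inl_snd _ _ i

theorem basis_inr_fst (j : Fin (m + 1)) : (basis K m (Sum.inr j)).1 = 0 :=
  Module.Basis.prod_apply_inr_fst _ _ j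

theorem basis_inr_snd (j : Fin (m + 1)) : (basis K m (Sum.inr j)).2 = Pi.single j 1 :=
  (Module.Basis.prod_apply_inr_snd _ _ j).trans (Pi.basisFun_apply K _ j)

theorem isKroneckerBasis_basis (K : Type u) [Field K] (m : ℕ) : IsKroneckerBasis (basis K m) := by
  -- Each `h_j` is a weight vector, so the mixed relations only require evaluating weights at unit
  -- vectors.
  have hgh : ∀ (i : Fin m) (j : Fin (m + 1)), ⁅basis K m (Sum.inl i), basis K m (Sum.inr j)⁆ =
      kroneckerWeight K m (Pi.single i 1) j • basis K m (Sum.inr j) := by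
    intro i j
    rw [lie_def, basis_inl_fst, basis_inl_snd, basis_inr_fst, basis_inr_snd]
    refine Prod.ext ((congrArg _ (basis_inr_fst j)).trans (smul_zero _)).symm ?_
    refine Eq.trans ?_ (congrArg (kroneckerWeight K m (Pi.single i 1) j • ·)
      (basis_inr_snd j)).symm
    ext l
    by_cases h : l = j
    · subst h; simp
    · simp [h]
  refine ⟨fun i => ?_, fun i => ?_, fun i j h0 h1 => ?_, fun i j => ?_, fun i j => ?_⟩
  · rw [hgh]
    simp [kroneckerWeight]
  · rw [hgh]
    simp [kroneckerWeight]
  · rw [hgh]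
    obtain ⟨j, rfl⟩ := Fin.exists_succ_eq.mpr h0
    have : j ≠ i := fun h => h1 (by rw [h])
    simp [kroneckerWeight, this]
  · rw [lie_def, basis_inl_snd, basis_inl_snd, mul_zero, mul_zero, sub_zero]
    rfl
  · rw [lie_def, basis_inr_fst, basis_inr_fst, map_zero, zero_mul, zero_mul, sub_zero]
    rfl

end KroneckerLieAlgebra

theorem theoremT (K : Type u) [Field K] [IsAlgClosed K] [CharZero K] :
    -- the Lie algebra with the given basis and brackets exists, for every `m ≥ 0`
    (∀ m : ℕ, ∃ (L : Type u) (_ : LieRing L) (_ : LieAlgebra K L)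
      (b : Module.Basis (Fin m ⊕ Fin (m + 1)) K L), IsKroneckerBasis b) ∧
    -- its invariants are a single Kronecker `(2m+1) × (2m+1)` block
    (∀ (m : ℕ) (L : Type v) [LieRing L] [LieAlgebra K L]
      (b : Module.Basis (Fin m ⊕ Fin (m + 1)) K L), IsKroneckerBasis b →
      HasJKInvariants K L { jordanTuples := 0, kroneckerSizes := {2 * m + 1} }) ∧
    -- the direct sum of such Lie algebras has the corresponding Kronecker blocks and no others
    (∀ (q : ℕ) (m : Fin q → ℕ) (L : Fin q → Type v) [∀ i, LieRing (L i)]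
      [∀ i, LieAlgebra K (L i)]
      (b : ∀ i, Module.Basis (Fin (m i) ⊕ Fin (m i + 1)) K (L i)),
      (∀ i, IsKroneckerBasis (b i)) →
      HasJKInvariants K (DirectSum (Fin q) L)
        { jordanTuples := 0, kroneckerSizes := Finset.univ.val.map fun i => 2 * m i + 1 }) ∧
    -- hence every finite collection of Kronecker sizes is realizable
    (∀ s : Multiset ℕ, (∀ n ∈ s, Odd n) →
      ∃ (L : Type u) (_ : LieRing L) (_ : LieAlgebra K L), FiniteDimensional K L ∧
        HasJKInvariants K L { jordanTuples := 0, kroneckerSizes := s }) := by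
  refine ⟨fun m => ⟨KroneckerLieAlgebra K m, inferInstance, inferInstance,
    KroneckerLieAlgebra.basis K m, KroneckerLieAlgebra.isKroneckerBasis_basis K m⟩,
    fun m L _ _ b hb => hasJKInvariants_of_isKroneckerBasis hb,
    fun q m L _ _ b hb => hasJKInvariants_directSum hb, fun s hs => ?_⟩
  obtain ⟨l, rfl⟩ := Quot.exists_rep s
  -- Rounded-down halving inverts `m ↦ 2 * m + 1` on odd sizes.
  let m : Fin l.length → ℕ := fun i => l[i] / 2
  have hm : ∀ i, 2 * m i + 1 = l[i] := fun i =>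
    Nat.two_mul_div_two_add_one_of_odd (hs _ (List.getElem_mem i.isLt))
  have hl : (Finset.univ.val.map fun i => 2 * m i + 1) = (l : Multiset ℕ) := by
    simp only [hm]
    rw [Fin.univ_val_map]
    exact congrArg _ List.ofFn_getElem
  refine ⟨DirectSum (Fin l.length) fun i => KroneckerLieAlgebra K (m i), inferInstance,
    inferInstance, ?_, ?_⟩
  · have : ∀ i, Module.Finite K (KroneckerLieAlgebra K (m i)) := fun i =>
      Module.Finite.of_basis (KroneckerLieAlgebra.basis K (m i))
    infer_instance
  · have := hasJKInvariants_directSum fun i =>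
      KroneckerLieAlgebra.isKroneckerBasis_basis K (m i)
    rw [hl] at this
    exact this
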